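/- For elements of a group write $x^y=y^{-1}xy$ and $[x,y]=x^{-1}y^{-1}xy$. For a group $Q$, the non-abelian exterior square $Q\wedge Q$ is the group generated by the symbols $x\wedge y$ $(x,y\in Q)$ subject to the relations $xy\wedge z=(x^y\wedge z^y)(y\wedge z)$, $x\wedge yz=(x\wedge z)(x^z\wedge y^z)$, $x\wedge x=1$ for all $x,y,z\in Q$. Let $\mathrm M_0(Q)=\langle x\wedge y\mid [x,y]=1\rangle$, a normal subgroup of $Q\wedge Q$; let $Q\curlywedge Q=(Q\wedge Q)/\mathrm M_0(Q)$ be the non-abelian curly exterior square, with $x\curlywedge y$ the image of $x\wedge y$; and let the Bogomolov multiplier $\mathrm B_0(Q)$ be the kernel of the homomorphism $Q\curlywedge Q\to[Q,Q]$, $x\curlywedge y\mapsto[x,y]$. A CP cover of $Q$ is a group extension $1\to N\to G\xrightarrow{\pi}Q\to 1$ such that the image of $N$ lies in $Z(G)\cap[G,G]$, every pair of commuting elements of $Q$ has a pair of commuting lifts in $G$, and $|N|=|\mathrm B_0(Q)|$. Two groups $G,H$ are isoclinic if there are isomorphisms $\alpha\colon G/Z(G)\to H/Z(H)$ and $\beta\colon[G,G]\to[H,H]$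 such that $\beta([x,y])=[x',y']$ whenever $\alpha(xZ(G))=x'Z(H)$ and $\alpha(yZ(G))=y'Z(H)$. **Proposition.** Let $Q_1$ and $Q_2$ be isoclinic groups, and assume that $\mathrm B_0(Q_1)$ is finite (which is the case whenever $Q_1$ is finite). Let $1\to N_i\to G_i\xrightarrow{\pi_i}Q_i\to1$ be a CP cover of $Q_i$, for $i=1,2$. Then $G_1$ and $G_2$ are isoclinic. Moreover, the derived subgroup of a CP cover is determined: for $i=1,2$ there is an isomorphism $[G_i,G_i]\to Q_i\curlywedge Q_i$ such that $[x,y]\mapsto\pi_i(x)\curlywedge\pi_i(y)$ for all $x,y\in G_i$. -/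

import Mathlib

/-! Conventions: `x ^ y = y⁻¹ x y` and `[x, y] = x⁻¹ y⁻¹ x y`. -/

namespace CPCovers

/-- The conjugate `x ^ y = y⁻¹ x y`. -/
def rconj {G : Type*} [Group G] (x y : G) : G := y⁻¹ * x * y

/-- The commutator `[x, y] = x⁻¹ y⁻¹ x y`, as an element of the derived subgroup `[G, G]`. -/
def comm {G : Type*} [Group G] (x y : G) : commutator G :=
  ⟨x⁻¹ * y⁻¹ * x * y, by
    have h := Subgroup.commutator_mem_commutator
      (Subgroup.mem_top x⁻¹) (Subgroup.mem_top y⁻¹)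
    rw [commutatorElement_def, inv_inv, inv_inv] at h
    exact h⟩

section ExteriorSquare

variable (Q : Type*) [Group Q]

/-- The defining relators of the non-abelian exterior square:
`xy ∧ z = (x^y ∧ z^y)(y ∧ z)`, `x ∧ yz = (x ∧ z)(x^z ∧ y^z)`, `x ∧ x = 1`;
the free generator `FreeGroup.of (x, y)` is the symbol `x ∧ y`. -/
inductive ExtRel : FreeGroup (Q × Q) → Prop
  | mul_left (x y z : Q) : ExtRel
      (FreeGroup.of (x * y, z) *
        (FreeGroup.of (rconj x y, rconj z y) * FreeGroup.of (y, z))⁻¹)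
  | mul_right (x y z : Q) : ExtRel
      (FreeGroup.of (x, y * z) *
        (FreeGroup.of (x, z) * FreeGroup.of (rconj x z, rconj y z))⁻¹)
  | self (x : Q) : ExtRel (FreeGroup.of (x, x))

/-- The non-abelian exterior square `Q ∧ Q`. -/
abbrev ExteriorSquare : Type _ := PresentedGroup {r | ExtRel Q r}

variable {Q}

/-- The element `x ∧ y` of `Q ∧ Q`. -/
def wedge (x y : Q) : ExteriorSquare Q := PresentedGroup.of (x, y)

theorem wedge_mul_left (x y z : Q) :
    wedge (x * y) z = wedge (rconj x y) (rconj z y) * wedge y z := by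
  have h := PresentedGroup.one_of_mem (rels := {r | ExtRel Q r}) (ExtRel.mul_left x y z)
  rw [map_mul, map_inv, mul_inv_eq_one, map_mul] at h
  exact h

theorem wedge_mul_right (x y z : Q) :
    wedge x (y * z) = wedge x z * wedge (rconj x z) (rconj y z) := by
  have h := PresentedGroup.one_of_mem (rels := {r | ExtRel Q r}) (ExtRel.mul_right x y z)
  rw [map_mul, map_inv, mul_inv_eq_one, map_mul] at h
  exact h

theorem wedge_conj (a b x y : Q) :
    wedge x y * wedge (rconj a (x * y)) (rconj b (x * y)) =
      wedge (rconj a (y * x)) (rconj b (y * x)) * wedge x y := by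
  have e : rconj (b * y) x = rconj b x * rconj y x := by simp [rconj, mul_assoc]
  have e' : rconj (a * x) y = rconj a y * rconj x y := by simp [rconj, mul_assoc]
  have e1 : ∀ c : Q, rconj (rconj c x) (rconj y x) = rconj c (y * x) := fun c => by
    simp [rconj, mul_assoc]
  have e2 : ∀ c : Q, rconj (rconj c y) (rconj x y) = rconj c (x * y) := fun c => by
    simp [rconj, mul_assoc]
  have h2 := (wedge_mul_left a x (b * y)).symm.trans (wedge_mul_right (a * x) b y)
  rw [e, e', wedge_mul_right (rconj a x), wedge_mul_right x b y, wedge_mul_left a x y,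
    wedge_mul_left (rconj a y), e1, e1, e2, e2] at h2
  simp only [mul_assoc] at h2
  have h3 := mul_left_cancel h2
  simp only [← mul_assoc] at h3
  exact (mul_right_cancel h3).symm

variable (Q)

/-- The commutator homomorphism `Q ∧ Q → [Q, Q]`, `x ∧ y ↦ [x, y]`; its kernel is the
Schur multiplier of `Q`. -/
def extCommMap : ExteriorSquare Q →* commutator Q :=
  PresentedGroup.toGroup (f := fun p : Q × Q => comm p.1 p.2) (by
    rintro r hr
    cases hr with
    | mul_left x y z =>
      apply Subtype.ext
      simp [comm, rconj, mul_assoc]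
    | mul_right x y z =>
      apply Subtype.ext
      simp [comm, rconj, mul_assoc]
    | self x =>
      apply Subtype.ext
      simp [comm])

theorem extCommMap_wedge (x y : Q) : extCommMap Q (wedge x y) = comm x y :=
  PresentedGroup.toGroup.of _

/-- `M₀(Q)`, the subgroup of `Q ∧ Q` generated by all `x ∧ y` with `[x, y] = 1`. -/
def M0 : Subgroup (ExteriorSquare Q) :=
  Subgroup.closure {w | ∃ x y : Q, Commute x y ∧ w = wedge x y}

instance M0_normal : (M0 Q).Normal := by
  have key : ∀ x y : Q, ∀ w ∈ M0 Q,
      wedge x y * w * (wedge x y)⁻¹ ∈ M0 Q ∧ (wedge x y)⁻¹ * w * wedge x y ∈ M0 Q := by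
    intro x y w hw
    have com : ∀ a b g : Q, Commute a b → Commute (rconj a g) (rconj b g) := by
      intro a b g h
      have h' := h.eq
      change rconj a g * rconj b g = rconj b g * rconj a g
      have e : ∀ c d : Q, rconj c g * rconj d g = rconj (c * d) g := fun c d => by
        simp [rconj, mul_assoc]
      rw [e, e, h']
    induction hw using Subgroup.closure_induction with
    | mem w hw =>
      obtain ⟨a, b, hab, rfl⟩ := hw
      have inv : ∀ c g : Q, rconj (rconj c g⁻¹) g = c := fun c g => by
        simp [rconj, mul_assoc]
      constructor
      · have h := wedge_conj (rconj a (x * y)⁻¹) (rconj b (x * y)⁻¹) x y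
        rw [inv, inv] at h
        rw [h, mul_inv_cancel_right]
        exact Subgroup.subset_closure ⟨_, _, com _ _ _ (com _ _ _ hab), rfl⟩
      · have h := wedge_conj (rconj a (y * x)⁻¹) (rconj b (y * x)⁻¹) x y
        rw [inv, inv] at h
        rw [mul_assoc, ← h, inv_mul_cancel_left]
        exact Subgroup.subset_closure ⟨_, _, com _ _ _ (com _ _ _ hab), rfl⟩
    | one => simp [(M0 Q).one_mem]
    | mul u v _ _ hu hv =>
      refine ⟨?_, ?_⟩
      · have := (M0 Q).mul_mem hu.1 hv.1
        simpa [mul_assoc] using this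
      · have := (M0 Q).mul_mem hu.2 hv.2
        simpa [mul_assoc] using this
    | inv u _ hu =>
      refine ⟨?_, ?_⟩
      · have := (M0 Q).inv_mem hu.1
        simpa [mul_assoc] using this
      · have := (M0 Q).inv_mem hu.2
        simpa [mul_assoc] using this
  refine ⟨fun w hw g => ?_⟩
  have hg : g ∈ Subgroup.closure (Set.range
      (PresentedGroup.of : Q × Q → ExteriorSquare Q)) := by
    rw [PresentedGroup.closure_range_of]; trivial
  revert w
  induction hg using Subgroup.closure_induction'' with
  | one => intro w hw; simpa using hw
  | mem g hg =>
    obtain ⟨⟨x, y⟩, rfl⟩ := hg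
    exact fun w hw => (key x y w hw).1
  | inv_mem g hg =>
    obtain ⟨⟨x, y⟩, rfl⟩ := hg
    intro w hw
    rw [inv_inv]
    exact (key x y w hw).2
  | mul g h _ _ ihg ihh =>
    intro w hw
    have := ihg _ (ihh _ hw)
    simpa [mul_assoc] using this

/-- The non-abelian curly exterior square `Q ⋏ Q = (Q ∧ Q) / M₀(Q)`. -/
abbrev CurlySquare : Type _ := ExteriorSquare Q ⧸ M0 Q

variable {Q}

/-- The element `x ⋏ y` of `Q ⋏ Q`. -/
def curlyWedge (x y : Q) : CurlySquare Q := QuotientGroup.mk (wedge x y)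

variable (Q)

/-- The commutator homomorphism `Q ⋏ Q → [Q, Q]`, `x ⋏ y ↦ [x, y]`. -/
def curlyCommMap : CurlySquare Q →* commutator Q :=
  QuotientGroup.lift (M0 Q) (extCommMap Q) (by
    intro w hw
    revert w
    change M0 Q ≤ (extCommMap Q).ker
    rw [M0, Subgroup.closure_le]
    rintro w ⟨x, y, h, rfl⟩
    rw [SetLike.mem_coe, MonoidHom.mem_ker, extCommMap_wedge]
    apply Subtype.ext
    have h' := h.eq
    simp [comm, mul_assoc, h'])

/-- The Bogomolov multiplier `B₀(Q) = ker (Q ⋏ Q → [Q, Q])`. -/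
abbrev BogomolovMultiplier : Type _ := (curlyCommMap Q).ker

end ExteriorSquare

/-- Two groups are isoclinic if there are isomorphisms `α : G/Z(G) → H/Z(H)` and
`β : [G, G] → [H, H]` such that `β [x, y] = [x', y']` whenever `α (x Z(G)) = x' Z(H)` and
`α (y Z(G)) = y' Z(H)`. -/
def Isoclinic (G H : Type*) [Group G] [Group H] : Prop :=
  ∃ (α : G ⧸ Subgroup.center G ≃* H ⧸ Subgroup.center H)
    (β : commutator G ≃* commutator H),
    ∀ (x y : G) (x' y' : H),
      α (QuotientGroup.mk x) = QuotientGroup.mk x' →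
      α (QuotientGroup.mk y) = QuotientGroup.mk y' →
      β (comm x y) = comm x' y'

/-- An extension `1 → N → G → Q → 1` is a CP cover of `Q` if it is central, stem and
commutativity preserving, and `|N| = |B₀(Q)|`. -/
structure IsCPCover {N G Q : Type*} [Group N] [Group G] [Group Q]
    (e : GroupExtension N G Q) : Prop where
  central : e.inl.range ≤ Subgroup.center G
  stem : e.inl.range ≤ commutator G
  /-- commuting pairs of elements of `Q` have commuting lifts in `G` -/
  cp : ∀ x y : Q, Commute x y →
    ∃ g h : G, e.rightHom g = x ∧ e.rightHom h = y ∧ Commute g h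
  /-- equality of cardinal numbers -/
  card_eq : Nonempty (N ≃ BogomolovMultiplier Q)

open scoped commutatorElement in
/-- The Bogomolov multiplier of a finite group that has a CP cover is finite. -/
theorem IsCPCover.finite_bogomolov {N G Q : Type*} [Group N] [Group G] [Group Q]
    {e : GroupExtension N G Q} (he : IsCPCover e) [Finite Q] :
    Finite (BogomolovMultiplier Q) := by
  have hc : Finite (commutatorSet G) := by
    let s : Q → G := Function.surjInv e.rightHom_surjective
    have hs : ∀ g : G, s (e.rightHom g) * g⁻¹ ∈ Subgroup.center G := fun g => by
      apply he.central
      rw [e.range_inl_eq_ker_rightHom, MonoidHom.mem_ker, map_mul, map_inv, mul_inv_eq_one]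
      exact Function.surjInv_eq e.rightHom_surjective _
    refine Set.Finite.subset (Set.finite_range fun p : Q × Q => ⁅s p.1, s p.2⁆) ?_
    rintro _ ⟨g, h, rfl⟩
    refine ⟨(e.rightHom g, e.rightHom h), ?_⟩
    have key : ∀ a b g h : G, a * g⁻¹ ∈ Subgroup.center G → b * h⁻¹ ∈ Subgroup.center G →
        ⁅a, b⁆ = ⁅g, h⁆ := by
      intro a b g h ha hb
      obtain ⟨z, rfl⟩ : ∃ z, a = z * g := ⟨a * g⁻¹, by simp⟩
      obtain ⟨w, rfl⟩ : ∃ w, b = w * h := ⟨b * h⁻¹, by simp⟩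
      rw [mul_inv_cancel_right, Subgroup.mem_center_iff] at ha hb
      have h1 : ⁅z * g, w * h⁆ = ⁅g, w * h⁆ := by
        have : z * g * (w * h) * (g⁻¹ * z⁻¹) = g * (w * h) * g⁻¹ := by
          have := ha (g * (w * h) * g⁻¹)
          calc z * g * (w * h) * (g⁻¹ * z⁻¹) = z * (g * (w * h) * g⁻¹) * z⁻¹ := by group
            _ = _ := by rw [← this]; group
        rw [commutatorElement_def, commutatorElement_def, mul_inv_rev, this]
      have h2 : ⁅g, w * h⁆ = ⁅g, h⁆ := by
        have : g * (w * h) * g⁻¹ * (h⁻¹ * w⁻¹) = g * h * g⁻¹ * h⁻¹ := by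
          have := hb (g * h * g⁻¹ * h⁻¹)
          calc g * (w * h) * g⁻¹ * (h⁻¹ * w⁻¹) = (g * w) * (h * g⁻¹ * h⁻¹) * w⁻¹ := by group
            _ = w * (g * h * g⁻¹ * h⁻¹) * w⁻¹ := by rw [hb g]; group
            _ = _ := by rw [← this]; group
        rw [commutatorElement_def, commutatorElement_def, mul_inv_rev, this]
      rw [h1, h2]
    exact key _ _ _ _ (hs g) (hs h)
  have hfin : Finite e.inl.range :=
    Finite.of_injective _ (Subgroup.inclusion_injective he.stem)
  have hN : Finite N := 
    Finite.of_injective _ (e.inl.rangeRestrict_injective_iff.mpr e.inl_injective)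
  obtain ⟨f⟩ := he.card_eq
  exact Finite.of_equiv N f

end CPCovers

namespace CPCovers

/-! In a CP cover `G` of `Q`, two elements commute exactly when their images do, so `G/Z(G) ≅
Q/Z(Q)`, and commutators of lifts define a homomorphism `ψ : Q ⋏ Q → [G, G]`
(`IsCPCover.exists_hom`). It is surjective, and followed by `[G, G] → [Q, Q]` it is the commutator
map of `Q`. Since `N ≤ [G, G]`, `ψ` restricts to a surjection `B₀(Q) → N`. These sets are finite of
equal size, so the restriction is injective; as `ker ψ` lies in `B₀(Q)`, `ψ` is an isomorphism.

Moreover `x ⋏ y` depends only on `x` and `y` modulo the centre, and an isoclinism detects commuting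
pairs through `β`. Hence `Q ⋏ Q` is an isoclinism invariant (`IsIsoclinism.exists_curlyEquiv`), and
composing the isomorphisms gives the isoclinism of the covers. -/

theorem map_rconj {G H : Type*} [Group G] [Group H] (f : G →* H) (x y : G) :
    f (rconj x y) = rconj (f x) (f y) := by
  simp [rconj]

/-! ### Commutators as a function on `G/Z(G)` -/

section Comm

variable {G : Type*} [Group G]

theorem comm_mul_left (x y z : G) :
    comm (x * y) z = comm (rconj x y) (rconj z y) * comm y z := by
  apply Subtype.ext
  simp [comm, rconj, mul_assoc]

theorem comm_mul_right (x y z : G) :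
    comm x (y * z) = comm x z * comm (rconj x z) (rconj y z) := by
  apply Subtype.ext
  simp [comm, rconj, mul_assoc]

theorem comm_eq_one_iff {x y : G} : comm x y = 1 ↔ Commute x y := by
  rw [Subtype.ext_iff]
  change x⁻¹ * y⁻¹ * x * y = 1 ↔ x * y = y * x
  rw [mul_assoc, ← mul_inv_rev, inv_mul_eq_one, eq_comm]

theorem rconj_of_commute {x y : G} (h : Commute x y) : rconj x y = x := by
  rw [rconj, mul_assoc, h.eq, inv_mul_cancel_left]

theorem commute_of_mem_center {z : G} (hz : z ∈ Subgroup.center G) (y : G) : Commute z y :=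
  (Subgroup.mem_center_iff.1 hz y).symm

/-- A function of two variables that satisfies the relations of the curly exterior square depends
only on the classes of its arguments modulo the centre. -/
theorem congr_of_mk_center_eq {K : Type*} [Group K] {f : G → G → K}
    (hl : ∀ x y z, f (x * y) z = f (rconj x y) (rconj z y) * f y z)
    (hr : ∀ x y z, f x (y * z) = f x z * f (rconj x z) (rconj y z))
    (hc : ∀ x y, Commute x y → f x y = 1) {x x' y y' : G}
    (hx : (x : G ⧸ Subgroup.center G) = x') (hy : (y : G ⧸ Subgroup.center G) = y') :
    f x y = f x' y' := by
  -- Expanding the product, conjugation by the central `z` is trivial and the factor `f z b` is `1`.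
  have e1 : ∀ z ∈ Subgroup.center G, ∀ a b, f (a * z) b = f a b := fun z hz a b => by
    rw [hl, rconj_of_commute (commute_of_mem_center hz a).symm,
      rconj_of_commute (commute_of_mem_center hz b).symm, hc z b (commute_of_mem_center hz b),
      mul_one]
  have e2 : ∀ z ∈ Subgroup.center G, ∀ a b, f a (b * z) = f a b := fun z hz a b => by
    rw [hr, rconj_of_commute (commute_of_mem_center hz a).symm,
      rconj_of_commute (commute_of_mem_center hz b).symm,
      hc a z (commute_of_mem_center hz a).symm, one_mul]
  rw [QuotientGroup.eq] at hx hy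
  rw [← e1 _ hx x y, mul_inv_cancel_left, ← e2 _ hy x' y, mul_inv_cancel_left]

/-- The commutator of two elements of `G/Z(G)`, an element of `[G, G]`. -/
noncomputable def centerComm (x y : G ⧸ Subgroup.center G) : commutator G := comm x.out y.out

theorem centerComm_mk (x y : G) :
    centerComm (x : G ⧸ Subgroup.center G) (y : G ⧸ Subgroup.center G) = comm x y :=
  congr_of_mk_center_eq comm_mul_left comm_mul_right (fun _ _ => comm_eq_one_iff.2)
    (QuotientGroup.out_eq' _) (QuotientGroup.out_eq' _)

theorem closure_comm : Subgroup.closure {w | ∃ x y : G, w = comm x y} = ⊤ := by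
  rw [eq_top_iff]
  rintro ⟨w, hw⟩ -
  have hw' := hw
  rw [commutator_eq_closure] at hw'
  have key : Subgroup.closure (commutatorSet G) ≤
      (Subgroup.closure {w | ∃ x y : G, w = comm x y}).map (commutator G).subtype := by
    rw [Subgroup.closure_le]
    rintro _ ⟨x, y, rfl⟩
    -- Mathlib's `⁅x, y⁆` is `x y x⁻¹ y⁻¹`, hence the inverses.
    refine ⟨comm x⁻¹ y⁻¹, Subgroup.subset_closure ⟨_, _, rfl⟩, ?_⟩
    simp [comm, commutatorElement_def]
  obtain ⟨v, hv, rfl⟩ := key hw'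
  exact hv

end Comm

/-! ### Homomorphisms out of the curly exterior square -/

section CurlySquare

variable {Q : Type*} [Group Q]

theorem curlyWedge_mul_left (x y z : Q) :
    curlyWedge (x * y) z = curlyWedge (rconj x y) (rconj z y) * curlyWedge y z := by
  rw [curlyWedge, wedge_mul_left]
  rfl

theorem curlyWedge_mul_right (x y z : Q) :
    curlyWedge x (y * z) = curlyWedge x z * curlyWedge (rconj x z) (rconj y z) := by
  rw [curlyWedge, wedge_mul_right]
  rfl

theorem curlyWedge_eq_one {x y : Q} (h : Commute x y) : curlyWedge x y = 1 :=
  (QuotientGroup.eq_one_iff _).2 (Subgroup.subset_closure ⟨x, y, h, rfl⟩)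

theorem curlyCommMap_curlyWedge (x y : Q) : curlyCommMap Q (curlyWedge x y) = comm x y :=
  extCommMap_wedge Q x y

/-- The element `x ⋏ y` for `x`, `y` in `Q/Z(Q)`. -/
noncomputable def centerWedge (x y : Q ⧸ Subgroup.center Q) : CurlySquare Q := curlyWedge x.out y.out

theorem centerWedge_mk (x y : Q) :
    centerWedge (x : Q ⧸ Subgroup.center Q) (y : Q ⧸ Subgroup.center Q) = curlyWedge x y :=
  congr_of_mk_center_eq curlyWedge_mul_left curlyWedge_mul_right (fun _ _ => curlyWedge_eq_one)
    (QuotientGroup.out_eq' _) (QuotientGroup.out_eq' _)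

theorem CurlySquare.hom_ext {K : Type*} [Group K] {f g : CurlySquare Q →* K}
    (h : ∀ x y, f (curlyWedge x y) = g (curlyWedge x y)) : f = g := by
  apply QuotientGroup.monoidHom_ext
  apply PresentedGroup.ext
  rintro ⟨x, y⟩
  exact h x y

/-- The universal property of the curly exterior square. -/
def CurlySquare.lift {K : Type*} [Group K] (f : Q → Q → K)
    (hl : ∀ x y z, f (x * y) z = f (rconj x y) (rconj z y) * f y z)
    (hr : ∀ x y z, f x (y * z) = f x z * f (rconj x z) (rconj y z))
    (hc : ∀ x y, Commute x y → f x y = 1) : CurlySquare Q →* K :=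
  QuotientGroup.lift (M0 Q)
    (PresentedGroup.toGroup (f := fun p : Q × Q => f p.1 p.2) (by
      rintro r hr'
      cases hr' with
      | mul_left x y z => simp [hl x y z]
      | mul_right x y z => simp [hr x y z]
      | self x => simpa using hc x x (Commute.refl x)))
    (by
      intro w hw
      revert w
      change M0 Q ≤ MonoidHom.ker _
      rw [M0, Subgroup.closure_le]
      rintro w ⟨x, y, h, rfl⟩
      rw [SetLike.mem_coe, MonoidHom.mem_ker, wedge, PresentedGroup.toGroup.of]
      exact hc x y h)

theorem CurlySquare.lift_curlyWedge {K : Type*} [Group K] (f : Q → Q → K)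
    (hl : ∀ x y z, f (x * y) z = f (rconj x y) (rconj z y) * f y z)
    (hr : ∀ x y z, f x (y * z) = f x z * f (rconj x z) (rconj y z))
    (hc : ∀ x y, Commute x y → f x y = 1) (x y : Q) :
    CurlySquare.lift f hl hr hc (curlyWedge x y) = f x y := by
  rw [CurlySquare.lift, curlyWedge, wedge, QuotientGroup.lift_mk, PresentedGroup.toGroup.of]

/-- A function on `G × G` that satisfies the relations of the curly exterior square and is
computed by `f` on `G/Z(G)` induces a homomorphism from `Q ⋏ Q` for each homomorphism
`Q → G/Z(G)` compatible with commuting pairs. -/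
theorem CurlySquare.exists_hom_of_center {G K : Type*} [Group G] [Group K] {c : G → G → K}
    {f : G ⧸ Subgroup.center G → G ⧸ Subgroup.center G → K}
    (hf : ∀ x y : G, f x y = c x y)
    (hl : ∀ x y z, c (x * y) z = c (rconj x y) (rconj z y) * c y z)
    (hr : ∀ x y z, c x (y * z) = c x z * c (rconj x z) (rconj y z))
    (t : Q →* G ⧸ Subgroup.center G) (hc : ∀ x y, Commute x y → f (t x) (t y) = 1) :
    ∃ ψ : CurlySquare Q →* K, ∀ x y, ψ (curlyWedge x y) = f (t x) (t y) := by
  have mk_rconj : ∀ a b : G, ((rconj a b : G) : G ⧸ Subgroup.center G) =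
      rconj (a : G ⧸ Subgroup.center G) (b : G ⧸ Subgroup.center G) := fun _ _ => rfl
  refine ⟨CurlySquare.lift (fun x y => f (t x) (t y)) ?_ ?_ hc,
    CurlySquare.lift_curlyWedge _ _ _ _⟩
  · intro x y z
    simp only [map_mul, map_rconj]
    induction t x using QuotientGroup.induction_on with | H a
    induction t y using QuotientGroup.induction_on with | H b
    induction t z using QuotientGroup.induction_on with | H d
    rw [← QuotientGroup.mk_mul, ← mk_rconj, ← mk_rconj, hf, hf, hf, hl]
  · intro x y z
    simp only [map_mul, map_rconj]
    induction t x using QuotientGroup.induction_on with | H a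
    induction t y using QuotientGroup.induction_on with | H b
    induction t z using QuotientGroup.induction_on with | H d
    rw [← QuotientGroup.mk_mul, ← mk_rconj, ← mk_rconj, hf, hf, hf, hr]

end CurlySquare

/-! ### Isoclinism invariance of the curly exterior square -/

section Isoclinism

variable {G H : Type*} [Group G] [Group H]

/-- `(α, β)` is an isoclinism from `G` to `H`. -/
def IsIsoclinism (α : G ⧸ Subgroup.center G ≃* H ⧸ Subgroup.center H)
    (β : commutator G ≃* commutator H) : Prop :=
  ∀ (x y : G) (x' y' : H), α (QuotientGroup.mk x) = QuotientGroup.mk x' →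
    α (QuotientGroup.mk y) = QuotientGroup.mk y' → β (comm x y) = comm x' y'

variable {α : G ⧸ Subgroup.center G ≃* H ⧸ Subgroup.center H}
  {β : commutator G ≃* commutator H}

theorem IsIsoclinism.symm (h : IsIsoclinism α β) : IsIsoclinism α.symm β.symm := by
  intro x y x' y' hx hy
  rw [MulEquiv.symm_apply_eq] at hx hy ⊢
  exact (h x' y' x y hx.symm hy.symm).symm

/-- If `x` and `y` commute, then `[x', y'] = β [x, y] = 1`, so `x' ⋏ y' = 1`: the defining relations
survive the passage through `α`. -/
theorem IsIsoclinism.exists_hom (h : IsIsoclinism α β) :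
    ∃ ψ : CurlySquare G →* CurlySquare H, ∀ (x y : G) (x' y' : H),
      α (QuotientGroup.mk x) = QuotientGroup.mk x' →
      α (QuotientGroup.mk y) = QuotientGroup.mk y' →
      ψ (curlyWedge x y) = curlyWedge x' y' := by
  obtain ⟨ψ, hψ⟩ := CurlySquare.exists_hom_of_center centerWedge_mk curlyWedge_mul_left
    curlyWedge_mul_right (α.toMonoidHom.comp (QuotientGroup.mk' (Subgroup.center G))) (by
      intro x y hxy
      obtain ⟨x', hx⟩ := QuotientGroup.mk_surjective (α (QuotientGroup.mk x))
      obtain ⟨y', hy⟩ := QuotientGroup.mk_surjective (α (QuotientGroup.mk y))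
      change centerWedge (α (QuotientGroup.mk x)) (α (QuotientGroup.mk y)) = 1
      rw [← hx, ← hy, centerWedge_mk]
      apply curlyWedge_eq_one
      rw [← comm_eq_one_iff, ← h x y x' y' hx.symm hy.symm, comm_eq_one_iff.2 hxy, map_one])
  refine ⟨ψ, fun x y x' y' hx hy => ?_⟩
  rw [hψ, ← centerWedge_mk, ← hx, ← hy]
  rfl

/-- Isoclinic groups have isomorphic curly exterior squares. -/
theorem IsIsoclinism.exists_curlyEquiv (h : IsIsoclinism α β) :
    ∃ φ : CurlySquare G ≃* CurlySquare H,
      (∀ (x y : G) (x' y' : H), α (QuotientGroup.mk x) = QuotientGroup.mk x' →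
        α (QuotientGroup.mk y) = QuotientGroup.mk y' →
        φ (curlyWedge x y) = curlyWedge x' y') ∧
      ∀ w, curlyCommMap H (φ w) = β (curlyCommMap G w) := by
  obtain ⟨ψ, hψ⟩ := h.exists_hom
  obtain ⟨χ, hχ⟩ := h.symm.exists_hom
  refine ⟨MonoidHom.toMulEquiv ψ χ ?_ ?_, hψ, fun w => ?_⟩
  · refine CurlySquare.hom_ext fun x y => ?_
    obtain ⟨x', hx⟩ := QuotientGroup.mk_surjective (α (QuotientGroup.mk x))
    obtain ⟨y', hy⟩ := QuotientGroup.mk_surjective (α (QuotientGroup.mk y))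
    rw [MonoidHom.comp_apply, hψ x y x' y' hx.symm hy.symm,
      hχ x' y' x y (by rw [hx, MulEquiv.symm_apply_apply])
        (by rw [hy, MulEquiv.symm_apply_apply])]
    rfl
  · refine CurlySquare.hom_ext fun x y => ?_
    obtain ⟨x', hx⟩ := QuotientGroup.mk_surjective (α.symm (QuotientGroup.mk x))
    obtain ⟨y', hy⟩ := QuotientGroup.mk_surjective (α.symm (QuotientGroup.mk y))
    rw [MonoidHom.comp_apply, hχ x y x' y' hx.symm hy.symm,
      hψ x' y' x y (by rw [hx, MulEquiv.apply_symm_apply])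
        (by rw [hy, MulEquiv.apply_symm_apply])]
    rfl
  · have : (curlyCommMap H).comp ψ = β.toMonoidHom.comp (curlyCommMap G) := by
      refine CurlySquare.hom_ext fun x y => ?_
      obtain ⟨x', hx⟩ := QuotientGroup.mk_surjective (α (QuotientGroup.mk x))
      obtain ⟨y', hy⟩ := QuotientGroup.mk_surjective (α (QuotientGroup.mk y))
      rw [MonoidHom.comp_apply, MonoidHom.comp_apply, hψ x y x' y' hx.symm hy.symm,
        curlyCommMap_curlyWedge, curlyCommMap_curlyWedge]
      exact (h x y x' y' hx.symm hy.symm).symm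
    exact DFunLike.congr_fun this w

/-- The isomorphism of curly squares intertwines the commutator maps via the injective `β`, so its
inverse carries kernel into kernel. -/
theorem Isoclinic.finite_bogomolov [Finite (BogomolovMultiplier G)] (h : Isoclinic G H) :
    Finite (BogomolovMultiplier H) := by
  obtain ⟨α, β, h⟩ := h
  obtain ⟨φ, -, hφ⟩ := IsIsoclinism.exists_curlyEquiv h
  refine Finite.of_injective (β := BogomolovMultiplier G)
    (fun w => ⟨φ.symm w.1, ?_⟩) fun v w hvw => ?_
  · rw [MonoidHom.mem_ker, ← map_eq_one_iff β β.injective, ← hφ, MulEquiv.apply_symm_apply]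
    exact w.2
  · exact Subtype.ext (φ.symm.injective (congrArg Subtype.val hvw))

end Isoclinism

/-! ### CP covers -/

namespace IsCPCover

variable {N G Q : Type*} [Group N] [Group G] [Group Q] {e : GroupExtension N G Q}

theorem mk_center_eq (he : IsCPCover e) {g h : G} (hgh : e.rightHom g = e.rightHom h) :
    (g : G ⧸ Subgroup.center G) = h := by
  rw [QuotientGroup.eq]
  apply he.central
  rw [e.range_inl_eq_ker_rightHom, MonoidHom.mem_ker, map_mul, map_inv, hgh, inv_mul_cancel]

/-- Lifts of one element differ by a central factor, so all pairs of lifts of a given pair have the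
same commutator; one commuting pair of lifts suffices. -/
theorem commute_iff (he : IsCPCover e) {g h : G} :
    Commute g h ↔ Commute (e.rightHom g) (e.rightHom h) := by
  refine ⟨fun hc => hc.map e.rightHom, fun hc => ?_⟩
  obtain ⟨g', h', hg, hh, hc'⟩ := he.cp _ _ hc
  rw [← comm_eq_one_iff, ← centerComm_mk, ← he.mk_center_eq hg, ← he.mk_center_eq hh,
    centerComm_mk, comm_eq_one_iff]
  exact hc'

theorem mem_center_iff (he : IsCPCover e) {g : G} :
    g ∈ Subgroup.center G ↔ e.rightHom g ∈ Subgroup.center Q := by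
  rw [Subgroup.mem_center_iff, Subgroup.mem_center_iff, e.rightHom_surjective.forall
    (p := fun q => q * e.rightHom g = e.rightHom g * q)]
  exact forall_congr' fun h => he.commute_iff (g := h) (h := g)

theorem exists_centerEquiv (he : IsCPCover e) :
    ∃ γ : G ⧸ Subgroup.center G ≃* Q ⧸ Subgroup.center Q,
      ∀ g : G, γ (QuotientGroup.mk g) = QuotientGroup.mk (e.rightHom g) := by
  let p : G →* Q ⧸ Subgroup.center Q := (QuotientGroup.mk' _).comp e.rightHom
  have hp : Subgroup.center G = p.ker := by
    ext g
    rw [he.mem_center_iff, MonoidHom.mem_ker]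
    exact (QuotientGroup.eq_one_iff _).symm
  exact ⟨(QuotientGroup.quotientMulEquivOfEq hp).trans
    (QuotientGroup.quotientKerEquivOfSurjective p
      ((QuotientGroup.mk'_surjective _).comp e.rightHom_surjective)), fun _ => rfl⟩

/-- The commutator on `G/Z(G)`, pulled back to `Q` through `Q/Z(Q) ≅ G/Z(G)`, kills commuting pairs
because they have commuting lifts. -/
theorem exists_hom (he : IsCPCover e) :
    ∃ ψ : CurlySquare Q →* commutator G, ∀ g h : G,
      ψ (curlyWedge (e.rightHom g) (e.rightHom h)) = comm g h := by
  obtain ⟨γ, hγ⟩ := he.exists_centerEquiv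
  have ht : ∀ g : G, γ.symm (QuotientGroup.mk (e.rightHom g)) = QuotientGroup.mk g := fun g => by
    rw [← hγ, MulEquiv.symm_apply_apply]
  obtain ⟨ψ, hψ⟩ := CurlySquare.exists_hom_of_center centerComm_mk comm_mul_left
    comm_mul_right (γ.symm.toMonoidHom.comp (QuotientGroup.mk' (Subgroup.center Q))) (by
      intro x y hxy
      obtain ⟨g, h, rfl, rfl, hc⟩ := he.cp x y hxy
      change centerComm (γ.symm (QuotientGroup.mk _)) (γ.symm (QuotientGroup.mk _)) = 1
      rw [ht, ht, centerComm_mk, comm_eq_one_iff]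
      exact hc)
  refine ⟨ψ, fun g h => (hψ _ _).trans ?_⟩
  change centerComm (γ.symm (QuotientGroup.mk _)) (γ.symm (QuotientGroup.mk _)) = _
  rw [ht, ht, centerComm_mk]

/-- The derived subgroup of a CP cover of `Q` is isomorphic to `Q ⋏ Q`. -/
theorem exists_commutatorEquiv [Finite (BogomolovMultiplier Q)] (he : IsCPCover e) :
    ∃ φ : commutator G ≃* CurlySquare Q, ∀ x y : G,
      φ (comm x y) = curlyWedge (e.rightHom x) (e.rightHom y) := by
  obtain ⟨ψ, hψ⟩ := he.exists_hom
  have hsurj : Function.Surjective ψ := by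
    rw [← MonoidHom.range_eq_top, eq_top_iff, ← closure_comm, Subgroup.closure_le]
    rintro _ ⟨x, y, rfl⟩
    exact ⟨_, hψ x y⟩
  have hcomm : ∀ w, e.rightHom (ψ w : G) = (curlyCommMap Q w : Q) := by
    have : (e.rightHom.comp (commutator G).subtype).comp ψ =
        (commutator Q).subtype.comp (curlyCommMap Q) := by
      refine CurlySquare.hom_ext fun x y => ?_
      obtain ⟨g, rfl⟩ := e.rightHom_surjective x
      obtain ⟨h, rfl⟩ := e.rightHom_surjective y
      simp only [MonoidHom.comp_apply, hψ, curlyCommMap_curlyWedge]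
      simp [comm]
    exact DFunLike.congr_fun this
  have hmem : ∀ w, curlyCommMap Q w = 1 ↔ (ψ w : G) ∈ e.inl.range := fun w => by
    rw [e.range_inl_eq_ker_rightHom, MonoidHom.mem_ker, hcomm, OneMemClass.coe_eq_one]
  -- `B₀(Q)` is the full preimage of `N` under `ψ`; with `N ≤ [G, G]` and `ψ` onto, the restriction
  -- is onto `N`.
  let θ : BogomolovMultiplier Q → e.inl.range := fun w => ⟨ψ w.1, (hmem w.1).1 w.2⟩
  have hθ : Function.Surjective θ := by
    rintro ⟨n, hn⟩
    obtain ⟨w, hw⟩ := hsurj ⟨n, he.stem hn⟩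
    have hw' : (ψ w : G) = n := congrArg Subtype.val hw
    exact ⟨⟨w, (hmem w).2 (hw' ▸ hn)⟩, Subtype.ext hw'⟩
  obtain ⟨b⟩ := he.card_eq
  -- Finiteness is essential here: only then does a surjection between equipotent sets have to be
  -- injective.
  have hθ' : Function.Injective θ :=
    (Finite.injective_iff_surjective_of_equiv
      (b.symm.trans (MonoidHom.ofInjective e.inl_injective).toEquiv)).2 hθ
  have hinj : Function.Injective ψ := by
    rw [injective_iff_map_eq_one]
    intro w hw
    have hw1 : curlyCommMap Q w = 1 := by
      rw [hmem, hw]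
      exact one_mem _
    have : (⟨w, hw1⟩ : BogomolovMultiplier Q) = 1 := hθ' (Subtype.ext (by simp [θ, hw]))
    exact congrArg Subtype.val this
  refine ⟨(MulEquiv.ofBijective ψ ⟨hinj, hsurj⟩).symm, fun x y => ?_⟩
  rw [MulEquiv.symm_apply_eq]
  exact (hψ x y).symm

end IsCPCover

end CPCovers

theorem proposition4p9 {N₁ G₁ Q₁ N₂ G₂ Q₂ : Type*}
    [Group N₁] [Group G₁] [Group Q₁] [Group N₂] [Group G₂] [Group Q₂]
    [Finite (CPCovers.BogomolovMultiplier Q₁)]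
    (hQ : CPCovers.Isoclinic Q₁ Q₂)
    (e₁ : GroupExtension N₁ G₁ Q₁) (he₁ : CPCovers.IsCPCover e₁)
    (e₂ : GroupExtension N₂ G₂ Q₂) (he₂ : CPCovers.IsCPCover e₂) :
    CPCovers.Isoclinic G₁ G₂ ∧
    (∃ φ : commutator G₁ ≃* CPCovers.CurlySquare Q₁, ∀ x y : G₁,
      φ (CPCovers.comm x y) = CPCovers.curlyWedge (e₁.rightHom x) (e₁.rightHom y)) ∧
    (∃ φ : commutator G₂ ≃* CPCovers.CurlySquare Q₂, ∀ x y : G₂,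
      φ (CPCovers.comm x y) = CPCovers.curlyWedge (e₂.rightHom x) (e₂.rightHom y)) := by
 
  -- Finiteness is assumed for `Q₁` only; isoclinism transfers it to `Q₂`.
  have := hQ.finite_bogomolov
  obtain ⟨φ₁, hφ₁⟩ := he₁.exists_commutatorEquiv
  obtain ⟨φ₂, hφ₂⟩ := he₂.exists_commutatorEquiv
  refine ⟨?_, ⟨φ₁, hφ₁⟩, ⟨φ₂, hφ₂⟩⟩
  obtain ⟨α, β, h⟩ := hQ
  obtain ⟨χ, hχ, -⟩ := CPCovers.IsIsoclinism.exists_curlyEquiv h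
  obtain ⟨γ₁, hγ₁⟩ := he₁.exists_centerEquiv
  obtain ⟨γ₂, hγ₂⟩ := he₂.exists_centerEquiv
  refine ⟨(γ₁.trans α).trans γ₂.symm, (φ₁.trans χ).trans φ₂.symm, fun x y x' y' hx hy => ?_⟩
  simp only [MulEquiv.trans_apply] at hx hy ⊢
  rw [MulEquiv.symm_apply_eq, hγ₁, hγ₂] at hx hy
  rw [MulEquiv.symm_apply_eq, hφ₁, hφ₂]
  exact hχ _ _ _ _ hx hy
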